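/- Let $\omega^\omega$ be ordered coordinatewise, that is, $f\le g$ means $f(n)\le g(n)$ for all $n\in\omega$, and let $2^{\omega_1}$ carry the product topology. A subset $Y$ of $2^{\omega_1}$ is called BIG if it is compact and there is a $\delta\in\omega_1$ such that $\pi_\delta[Y]=2^{\omega_1\setminus\delta}$, where $\pi_\delta:2^{\omega_1}\to 2^{\omega_1\setminus\delta}$ is the projection $x\mapsto x\restriction(\omega_1\setminus\delta)$. For a countable sequence of zeros and ones $\rho\in 2^{<\omega_1}=\bigcup_{\alpha<\omega_1}2^\alpha$ put $[\rho]=\{x\in 2^{\omega_1}:\rho\subseteq x\}$; these sets form the standard base of the $G_\delta$-topology on $2^{\omega_1}$. Let $\langle K_f:f\in\omega^\omega\rangle$ be an order-preserving cover of $2^{\omega_1}$ by compact sets, that is, every $K_f$ is a compact subset of $2^{\omega_1}$, $\bigcup_{f\in\omega^\omega}K_f=2^{\omega_1}$, and $f\le g$ implies $K_f\subseteq K_g$. Then there is an $f\in\omega^\omega$ such that $K_f$ is BIG. Moreover, whenever $K_f$ is BIG there is a $\rho\in 2^{<\omega_1}$ such that $[\rho]\subseteq K_f$. -/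

import Mathlib

open scoped Ordinal

/-- The set `ω₁` of all countable ordinals. -/
abbrev OmegaOne : Type 1 := Set.Iio (ω₁ : Ordinal.{0})

/-- The Cantor cube `2^ω₁`, with the product topology. -/
abbrev CantorCube : Type 1 := OmegaOne → Bool

/-- The projection `π_δ` of `2^ω₁` onto the final product `2^(ω₁ \ δ)`; as a set of ordinals,
`ω₁ \ δ` consists of the countable ordinals `α` with `δ ≤ α`. -/
def finalProj (δ : OmegaOne) (x : CantorCube) : Set.Ici δ → Bool := fun α => x α

/-- A subset of `2^ω₁` is BIG if it is compact and some projection `π_δ` maps it onto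
the whole final product `2^(ω₁ \ δ)`. -/
def IsBIG (Y : Set CantorCube) : Prop :=
  IsCompact Y ∧ ∃ δ : OmegaOne, finalProj δ '' Y = Set.univ

/-- A node of the binary tree `2^(<ω₁)`: a sequence of zeros and ones whose domain is
a countable ordinal. -/
structure TreeNode where
  dom : OmegaOne
  val : Set.Iio dom → Bool

/-- The set `[ρ]` of all points of `2^ω₁` that extend `ρ`; these sets are the standard base of
the `G_δ`-topology. -/
def TreeNode.cylinder (ρ : TreeNode) : Set CantorCube :=
  {x | ∀ α : Set.Iio ρ.dom, x α = ρ.val α}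

/-- An order-preserving cover of `X` by compact sets, indexed by `ω^ω` with the
coordinatewise order. -/
structure IsOrderPreservingCompactCover {X : Type*} [TopologicalSpace X]
    (K : (ℕ → ℕ) → Set X) : Prop where
  isCompact : ∀ f, IsCompact (K f)
  mono : ∀ f g : ℕ → ℕ, (∀ n, f n ≤ g n) → K f ⊆ K g
  cover : ⋃ f, K f = Set.univ

open Set Filter

/-! A closed set containing no cylinder over a countable set of coordinates is nowhere dense in the
$G_\delta$-topology. By compactness, decreasing chains of such cylinders have nonempty intersection,
so $\omega_1$ many dense conditions can be met at once (`exists_generic`). Deciding the countably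
many finite patterns below $\delta$ in this way turns a BIG set into one containing a cylinder
(`IsBIG.exists_cyl_subset`).

The existence of a BIG $K_f$ splits by the cardinals $\mathfrak b$ and $\mathfrak d$. If $\mathfrak
d=\aleph_1$, a generic point avoids $\aleph_1$ nowhere dense sets $K_f$ indexed by a dominating
family, which is absurd (`exists_isBIG_of_dominating`). If $\mathfrak b>\aleph_1$, approximations to
a countable dense set, one batch for each $\alpha<\omega_1$, have indices bounded modulo finite by
one function; uncountably many batches then lie in a single $K_f$ (`exists_isBIG_of_bounded`). If
$\mathfrak b=\aleph_1<\mathfrak d$, counting crossings in an unbounded chain produces points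
$x_\alpha$ such that every uncountable subfamily has a countable part meeting nearly all finite
conditions (`exists_forall_mem_cyl`). As no $\aleph_1$ functions dominate, finitely many of these
points at each level suffice, and one $K_f$ holds them all (`exists_isBIG_of_isUnboundedChain`). -/

/-! ### Countable and uncountable sets of countable ordinals -/

theorem mk_omegaOne : Cardinal.mk OmegaOne = Cardinal.aleph 1 := by
  simp [OmegaOne, Cardinal.mk_Iio_ordinal]

instance : Infinite OmegaOne := by
  rw [Cardinal.infinite_iff, mk_omegaOne]
  exact Cardinal.aleph0_le_aleph 1

theorem not_countable_univ_omegaOne : ¬ (univ : Set OmegaOne).Countable := by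
  rw [← Cardinal.le_aleph0_iff_set_countable, Cardinal.mk_univ, mk_omegaOne, not_le]
  exact Cardinal.aleph0_lt_aleph_one

theorem countable_Iio_omegaOne (δ : OmegaOne) : (Iio δ).Countable := by
  have h : (Subtype.val '' Iio δ).Countable := by
    have h1 : (Iio (δ : Ordinal.{0})).Countable := by
      rw [← Cardinal.le_aleph0_iff_set_countable, Cardinal.mk_Iio_ordinal,
        Cardinal.lift_le_aleph0, ← Cardinal.lt_aleph_one_iff, ← Cardinal.lt_ord]
      rw [Cardinal.ord_aleph]
      exact δ.2
    refine h1.mono ?_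
    rintro _ ⟨a, ha, rfl⟩
    exact ha
  exact countable_of_injective_of_countable_image Subtype.val_injective.injOn h

theorem exists_forall_lt_of_countable {A : Set OmegaOne} (hA : A.Countable) :
    ∃ δ : OmegaOne, ∀ a ∈ A, a < δ := by
  have := hA.to_subtype
  have hs : ∀ a : A, Order.succ ((a : OmegaOne) : Ordinal.{0}) < ω₁ := fun a =>
    (Cardinal.isSuccLimit_omega 1).succ_lt a.1.2
  let g : A → Ordinal.{0} := fun a => Order.succ ((a : OmegaOne) : Ordinal.{0})
  have hbdd : BddAbove (range g) := ⟨ω₁, by rintro _ ⟨a, rfl⟩; exact (hs a).le⟩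
  refine ⟨⟨⨆ a, g a, Ordinal.iSup_lt_omega_one hs⟩, fun a ha => ?_⟩
  have h : g ⟨a, ha⟩ ≤ ⨆ a, g a := le_ciSup hbdd _
  exact Subtype.coe_lt_coe.1 (lt_of_lt_of_le (Order.lt_succ (a : Ordinal.{0})) h)

theorem exists_le_of_not_countable {A : Set OmegaOne} (hA : ¬ A.Countable) (δ : OmegaOne) :
    ∃ a ∈ A, δ ≤ a := by
  by_contra! h
  exact hA ((countable_Iio_omegaOne δ).mono h)

theorem not_countable_inter_Ici {A : Set OmegaOne} (hA : ¬ A.Countable) (δ : OmegaOne) :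
    ¬ (A ∩ Ici δ).Countable := by
  intro h
  refine hA ((h.union (countable_Iio_omegaOne δ)).mono fun a ha => ?_)
  rcases le_or_gt δ a with h | h
  · exact Or.inl ⟨ha, h⟩
  · exact Or.inr h

theorem exists_not_countable_fiber {ι γ : Type*} [Countable γ] {A : Set ι} (hA : ¬ A.Countable)
    (c : ι → γ) : ∃ i, ¬ {a ∈ A | c a = i}.Countable := by
  by_contra! h
  refine hA ((countable_iUnion h).mono fun a ha => ?_)
  exact mem_iUnion.2 ⟨c a, ha, rfl⟩

theorem exists_wellFounded_choice {ι β : Type*} [Preorder ι] [WellFoundedLT ι] [Nonempty β]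
    (Q : ι → β → Prop) (R : β → β → Prop)
    (step : ∀ (a : ι) (g : ι → β), (∀ b < a, Q b (g b) ∧ ∀ c < b, R (g c) (g b)) →
      ∃ w, Q a w ∧ ∀ c < a, R (g c) w) :
    ∃ g : ι → β, ∀ a, Q a (g a) ∧ ∀ c < a, R (g c) (g a) := by
  classical
  let F : (a : ι) → ((b : ι) → b < a → β) → β := fun a ih =>
    Classical.epsilon fun w => Q a w ∧ ∀ c (hc : c < a), R (ih c hc) w
  let g : ι → β := (wellFounded_lt (α := ι)).fix F
  have hg : ∀ a, g a = Classical.epsilon fun w => Q a w ∧ ∀ c < a, R (g c) w := fun a =>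
    (wellFounded_lt (α := ι)).fix_eq F a
  refine ⟨g, fun a => ?_⟩
  induction a using (wellFounded_lt (α := ι)).induction with
  | _ a ih =>
    rw [hg a]
    exact Classical.epsilon_spec (step a g ih)

/-! ### Cylinders and genericity in the $G_\delta$-topology -/

/-- The set of points that agree with `x` on `A`. -/
def cyl (x : CantorCube) (A : Set OmegaOne) : Set CantorCube := {y | EqOn y x A}

theorem self_mem_cyl (x : CantorCube) (A : Set OmegaOne) : x ∈ cyl x A := fun _ _ => rfl

theorem cyl_subset_cyl {x y : CantorCube} {A B : Set OmegaOne} (hy : y ∈ cyl x A) (h : A ⊆ B) :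
    cyl y B ⊆ cyl x A := fun _ hz _ ha => (hz (h ha)).trans (hy ha)

theorem isClosed_cyl (x : CantorCube) (A : Set OmegaOne) : IsClosed (cyl x A) := by
  have : cyl x A = ⋂ a ∈ A, {y | y a = x a} := by
    ext y; simp [cyl, EqOn]
  rw [this]
  exact isClosed_biInter fun a _ => isClosed_eq (continuous_apply a) continuous_const

theorem exists_disjoint_cyl_of_notMem {L : Set CantorCube} (hL : IsClosed L) {x : CantorCube}
    (hx : x ∉ L) : ∃ F : Finset OmegaOne, ∀ y ∈ cyl x F, y ∉ L := by
  have h : Lᶜ ∈ nhds x := hL.isOpen_compl.mem_nhds hx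
  rw [nhds_pi, Filter.mem_pi] at h
  obtain ⟨I, hI, t, ht, hsub⟩ := h
  refine ⟨hI.toFinset, fun y hy => hsub fun i hi => ?_⟩
  rw [hy (by simpa using hi)]
  exact mem_of_mem_nhds (ht i)

theorem exists_mem_iInter_cyl {ι : Type*} [Nonempty ι] (z : ι → CantorCube)
    (A : ι → Set OmegaOne) (h : Directed (· ⊇ ·) fun i => cyl (z i) (A i)) :
    ∃ x, ∀ i, x ∈ cyl (z i) (A i) := by
  obtain ⟨x, hx⟩ := IsCompact.nonempty_iInter_of_directed_nonempty_isCompact_isClosed _ h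
    (fun i => ⟨z i, self_mem_cyl _ _⟩) (fun i => (isClosed_cyl _ _).isCompact)
    (fun i => isClosed_cyl _ _)
  exact ⟨x, mem_iInter.1 hx⟩

/-- Any `ω₁` many dense conditions on countable partial points can be met at once. -/
theorem exists_generic (P : OmegaOne → CantorCube → Set OmegaOne → Prop)
    (dense : ∀ α x A, A.Countable → ∃ y ∈ cyl x A, ∃ B, B.Countable ∧ A ⊆ B ∧ P α y B)
    (mono : ∀ α x A y B, P α x A → y ∈ cyl x A → A ⊆ B → P α y B) :
    ∃ x, ∀ α, ∃ A, A.Countable ∧ P α x A := by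
  obtain ⟨g, hg⟩ : ∃ g : OmegaOne → CantorCube × Set OmegaOne, ∀ α,
      ((g α).2.Countable ∧ P α (g α).1 (g α).2) ∧
        ∀ β < α, (g α).1 ∈ cyl (g β).1 (g β).2 ∧ (g β).2 ⊆ (g α).2 := by
    refine exists_wellFounded_choice (β := CantorCube × Set OmegaOne) 
      (fun α w => w.2.Countable ∧ P α w.1 w.2) (fun v w => w.1 ∈ cyl v.1 v.2 ∧ v.2 ⊆ w.2) fun α g hg => ?_
    -- Limit stages survive by compactness: the earlier cylinders are nested, closed and nonempty.
    have hx : ∃ x, ∀ β < α, x ∈ cyl (g β).1 (g β).2 := by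
      rcases isEmpty_or_nonempty (Iio α) with hE | hE
      · exact ⟨fun _ => true, fun β hβ => (hE.false ⟨β, hβ⟩).elim⟩
      · have hdir : Directed (· ⊇ ·) fun β : Iio α => cyl (g β).1 (g β).2 := by
          refine directed_of_isDirected_le fun a b hab => ?_
          rcases hab.eq_or_lt with rfl | hab
          · exact subset_rfl
          · have := (hg b b.2).2 a hab
            exact cyl_subset_cyl this.1 this.2
        obtain ⟨x, hx⟩ := exists_mem_iInter_cyl _ _ hdir
        exact ⟨x, fun β hβ => hx ⟨β, hβ⟩⟩
    obtain ⟨x, hx⟩ := hx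
    obtain ⟨y, hy, B, hB, hAB, hP⟩ := dense α x (⋃ β ∈ Iio α, (g β).2)
      ((countable_Iio_omegaOne α).biUnion fun β hβ => (hg β hβ).1.1)
    refine ⟨(y, B), ⟨hB, hP⟩, fun c hc => ?_⟩
    have hsub : (g c).2 ⊆ ⋃ β ∈ Iio α, (g β).2 :=
      subset_biUnion_of_mem (u := fun β => (g β).2) (show c ∈ Iio α from hc)
    exact ⟨cyl_subset_cyl (hx c hc) hsub hy, hsub.trans hAB⟩
  have hdir : Directed (· ⊇ ·) fun α => cyl (g α).1 (g α).2 := by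
    refine directed_of_isDirected_le fun a b hab => ?_
    rcases hab.eq_or_lt with rfl | hab
    · exact subset_rfl
    · exact cyl_subset_cyl ((hg b).2 a hab).1 ((hg b).2 a hab).2
  obtain ⟨x, hx⟩ := exists_mem_iInter_cyl _ _ hdir
  exact ⟨x, fun α => ⟨(g α).2, (hg α).1.1, mono _ _ _ _ _ (hg α).1.2 (hx α) subset_rfl⟩⟩

/-- For countably many sets there is a countable partial point that decides each of them: the
set misses the cylinder or it is dense in it for the topology generated by all cylinders. -/
theorem exists_deciding {ι : Type*} [Countable ι] (C : ι → Set CantorCube) :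
    ∃ (x : CantorCube) (A : Set OmegaOne), A.Countable ∧ ∀ i, (∀ y ∈ cyl x A, y ∉ C i) ∨
      ∀ y ∈ cyl x A, ∀ B : Set OmegaOne, B.Countable → ∃ z ∈ cyl y B, z ∈ C i := by
  rcases isEmpty_or_nonempty ι with hE | hE
  · exact ⟨fun _ => true, ∅, countable_empty, fun i => (hE.false i).elim⟩
  let P : ι → CantorCube → Set OmegaOne → Prop := fun i x A => (∀ y ∈ cyl x A, y ∉ C i) ∨
      ∀ y ∈ cyl x A, ∀ B : Set OmegaOne, B.Countable → ∃ z ∈ cyl y B, z ∈ C i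
  have mono : ∀ i x A y B, P i x A → y ∈ cyl x A → A ⊆ B → P i y B := by
    intro i x A y B hP hy hAB
    rcases hP with hP | hP
    · exact Or.inl fun z hz => hP z (cyl_subset_cyl hy hAB hz)
    · exact Or.inr fun z hz => hP z (cyl_subset_cyl hy hAB hz)
  obtain ⟨e, he⟩ : ∃ e : OmegaOne → ι, Function.Surjective e := by
    obtain ⟨u, hu⟩ := exists_surjective_nat ι
    let j := Infinite.natEmbedding OmegaOne
    exact ⟨u ∘ Function.invFun j, hu.comp (Function.invFun_surjective j.injective)⟩
  have dense : ∀ α x A, A.Countable → ∃ y ∈ cyl x A, ∃ B, B.Countable ∧ A ⊆ B ∧ P (e α) y B := by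
    intro α x A hA
    by_cases h : ∀ y ∈ cyl x A, ∀ B : Set OmegaOne, B.Countable → ∃ z ∈ cyl y B, z ∈ C (e α)
    · exact ⟨x, self_mem_cyl _ _, A, hA, subset_rfl, Or.inr h⟩
    · push Not at h
      obtain ⟨y, hy, B, hB, h⟩ := h
      exact ⟨y, hy, A ∪ B, hA.union hB, subset_union_left,
        Or.inl fun z hz => h z (cyl_subset_cyl (self_mem_cyl _ _) subset_union_right hz)⟩
  obtain ⟨x, hx⟩ := exists_generic (fun α => P (e α)) dense fun α => mono (e α)
  have hx' : ∀ i, ∃ A : Set OmegaOne, A.Countable ∧ P i x A := fun i => by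
    obtain ⟨α, rfl⟩ := he i
    exact hx α
  choose A hA hP using hx'
  exact ⟨x, ⋃ i, A i, countable_iUnion hA, fun i =>
    mono i x (A i) x _ (hP i) (self_mem_cyl _ _) (subset_iUnion A i)⟩

/-! ### BIG sets -/

theorem isClosed_tailSaturation {L : Set CantorCube} (hL : IsCompact L) (δ : OmegaOne) :
    IsClosed {w : CantorCube | ∃ k ∈ L, ∀ a, δ ≤ a → k a = w a} := by
  have hcont : Continuous (finalProj δ) := continuous_pi fun a => continuous_apply _
  have : {w : CantorCube | ∃ k ∈ L, ∀ a, δ ≤ a → k a = w a} =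
      finalProj δ ⁻¹' (finalProj δ '' L) := by
    ext w
    constructor
    · rintro ⟨k, hk, h⟩
      exact ⟨k, hk, funext fun a => h a a.2⟩
    · rintro ⟨k, hk, h⟩
      exact ⟨k, hk, fun a ha => congrFun h ⟨a, ha⟩⟩
  rw [this]
  exact (hL.image hcont).isClosed.preimage hcont

theorem isBIG_iff_tailSaturation {K : Set CantorCube} :
    IsBIG K ↔ IsCompact K ∧ ∃ δ : OmegaOne, ∀ w : CantorCube, ∃ k ∈ K, ∀ a, δ ≤ a → k a = w a := by
  classical
  refine and_congr_right fun _ => exists_congr fun δ => ⟨fun h w => ?_, fun h => ?_⟩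
  · obtain ⟨k, hk, h⟩ : finalProj δ w ∈ finalProj δ '' K := h ▸ mem_univ _
    exact ⟨k, hk, fun a ha => congrFun h ⟨a, ha⟩⟩
  · refine eq_univ_of_forall fun z => ?_
    obtain ⟨k, hk, h⟩ := h fun a => if ha : δ ≤ a then z ⟨a, ha⟩ else true
    refine ⟨k, hk, funext fun a => (h a a.2).trans ?_⟩
    simp [show δ ≤ (a : OmegaOne) from a.2]

theorem isBIG_of_forall_meets {K : Set CantorCube} (hK : IsCompact K) (δ : OmegaOne)
    (h : ∀ (x : CantorCube) (F : Finset OmegaOne), (∀ a ∈ F, δ ≤ a) → ∃ k ∈ K, k ∈ cyl x F) :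
    IsBIG K := by
  classical
  refine isBIG_iff_tailSaturation.2 ⟨hK, δ, fun x => ?_⟩
  by_contra hx
  obtain ⟨F, hF⟩ := exists_disjoint_cyl_of_notMem (isClosed_tailSaturation hK δ) hx
  obtain ⟨k, hk, hkx⟩ := h x (F.filter (δ ≤ ·)) (by simp)
  refine hF (fun a => if δ ≤ a then k a else x a) (fun a ha => ?_) ⟨k, hk, fun a ha => by simp [ha]⟩
  by_cases hδ : δ ≤ a
  · simpa [hδ] using hkx (by simpa [hδ] using ha)
  · simp [hδ]

theorem isBIG_of_cyl_subset {K : Set CantorCube} (hK : IsCompact K) {x : CantorCube}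
    {A : Set OmegaOne} (hA : A.Countable) (h : cyl x A ⊆ K) : IsBIG K := by
  classical
  obtain ⟨δ, hδ⟩ := exists_forall_lt_of_countable hA
  refine isBIG_of_forall_meets hK δ fun y F hF =>
    ⟨fun a => if a ∈ A then x a else y a, h fun a ha => by simp [ha], fun a ha => ?_⟩
  have : a ∉ A := fun haA => (hδ a haA).not_ge (hF a ha)
  simp [this]

/-- There are only countably many finite patterns `τ` below `δ`, so one cylinder decides all the
closed sets `C τ`. Those not missed are dense in it, hence contain it. A point `k` of `K` above `x`
realises only patterns of the second kind, so fixing `k` below `δ` and on `A` leaves all other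
coordinates free. -/
theorem IsBIG.exists_cyl_subset {K : Set CantorCube} (hK : IsBIG K) :
    ∃ (x : CantorCube) (A : Set OmegaOne), A.Countable ∧ cyl x A ⊆ K := by
  classical
  obtain ⟨hK, δ, hδ⟩ := isBIG_iff_tailSaturation.1 hK
  have : Countable (Iio δ) := (countable_Iio_omegaOne δ).to_subtype
  let T : Finset (Iio δ) × Finset (Iio δ) → Set CantorCube := fun τ =>
    {k | ∀ a ∈ τ.1, k a = decide (a ∈ τ.2)}
  have hT : ∀ τ, IsClosed (T τ) := fun τ => by
    have : T τ = ⋂ a ∈ τ.1, {k : CantorCube | k a = decide (a ∈ τ.2)} := by ext; simp [T]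
    rw [this]
    exact isClosed_biInter fun a _ => isClosed_eq (continuous_apply _) continuous_const
  let C : Finset (Iio δ) × Finset (Iio δ) → Set CantorCube := fun τ =>
    {w | ∃ k ∈ K ∩ T τ, ∀ a, δ ≤ a → k a = w a}
  have hC : ∀ τ, IsClosed (C τ) := fun τ => isClosed_tailSaturation (hK.inter_right (hT τ)) δ
  obtain ⟨x, A, hA, hx⟩ := exists_deciding C
  obtain ⟨k, hk, hkx⟩ := hδ x
  refine ⟨k, Iio δ ∪ A, (countable_Iio_omegaOne δ).union hA, fun w hw => ?_⟩
  by_contra hwK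
  obtain ⟨F, hF⟩ := exists_disjoint_cyl_of_notMem hK.isClosed hwK
  let F' : Finset (Iio δ) := F.subtype (· < δ)
  let τ : Finset (Iio δ) × Finset (Iio δ) := (F', F'.filter fun a => k a = true)
  have hkT : k ∈ T τ := fun a ha => by
    have ha : a ∈ F' := ha
    simp [τ, ha]
  -- Only the tail of `y` matters for `C τ`; below `δ` it copies `x` so as to stay in the deciding
  -- cylinder.
  let y : CantorCube := fun a => if δ ≤ a then w a else x a
  have hy : y ∈ cyl x A := fun a ha => by
    by_cases h : δ ≤ a
    · simpa [y, h] using (hw (Or.inr ha)).trans (hkx a h)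
    · simp [y, h]
  have hyC : y ∈ C τ := by
    rcases hx τ with h | h
    · exact (h x (self_mem_cyl _ _) ⟨k, ⟨hk, hkT⟩, hkx⟩).elim
    · by_contra hyC
      obtain ⟨G, hG⟩ := exists_disjoint_cyl_of_notMem (hC τ) hyC
      obtain ⟨z, hz, hzC⟩ := h y hy G G.countable_toSet
      exact hG z hz hzC
  obtain ⟨k', ⟨hk', hk'T⟩, hk'y⟩ := hyC
  refine hF k' (fun a ha => ?_) hk'
  by_cases h : δ ≤ a
  · simpa [y, h] using hk'y a h
  · have h' : a < δ := not_le.1 h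
    have hmem : (⟨a, h'⟩ : Iio δ) ∈ F' := Finset.mem_subtype.2 ha
    have h1 := hk'T ⟨a, h'⟩ hmem
    have h2 := hkT ⟨a, h'⟩ hmem
    exact h1.trans (h2.symm.trans (hw (Or.inl h')).symm)

theorem IsBIG.exists_cylinder_subset {K : Set CantorCube} (hK : IsBIG K) :
    ∃ ρ : TreeNode, ρ.cylinder ⊆ K := by
  obtain ⟨x, A, hA, h⟩ := hK.exists_cyl_subset
  obtain ⟨δ, hδ⟩ := exists_forall_lt_of_countable hA
  exact ⟨⟨δ, fun a => x a⟩, fun y hy => h fun a ha => hy ⟨a, hδ a ha⟩⟩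

/-! ### Countably many codes for finite conditions -/

/-- Evaluate a code, a length and a finite set of sequences of that length, at a function. -/
def evalCode (q : ℕ × Finset (List ℕ)) (r : ℕ → ℕ) : Bool :=
  decide ((List.range q.1).map r ∈ q.2)

theorem exists_length_separating {ι : Type*} [Finite ι] {r : ι → ℕ → ℕ} (hr : r.Injective) :
    ∃ l, ∀ i j, (List.range l).map (r i) = (List.range l).map (r j) → i = j := by
  cases nonempty_fintype ι
  have h : ∀ i j, ∃ k, r i k = r j k → i = j := fun i j => by
    by_contra! h
    exact (h 0).2 (hr (funext fun k => (h k).1))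
  choose k hk using h
  refine ⟨(Finset.univ.sup fun i => Finset.univ.sup (k i)) + 1, fun i j h => hk i j ?_⟩
  refine List.map_inj_left.1 h (k i j) (List.mem_range.2 (Nat.lt_succ_of_le ?_))
  exact (Finset.le_sup (f := k i) (Finset.mem_univ j)).trans
    (Finset.le_sup (f := fun i => Finset.univ.sup (k i)) (Finset.mem_univ i))

theorem exists_code_of_separating {ι : Type*} [Finite ι] {t : ι → List ℕ} (ht : t.Injective)
    (p : ι → Bool) : ∃ W : Finset (List ℕ), ∀ i, t i ∈ W ↔ p i = true := by
  classical
  cases nonempty_fintype ι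
  refine ⟨(Finset.univ.filter fun i => p i = true).image t, fun i => ?_⟩
  simp [ht.eq_iff]

/-- Finitely many distinct functions already differ on a common initial segment. The countably many
codes thus yield a dense set of points of the cube. -/
theorem exists_code {r : OmegaOne → ℕ → ℕ} (hr : r.Injective) (F : Finset OmegaOne)
    (y : CantorCube) : ∃ q, ∀ a ∈ F, evalCode q (r a) = y a := by
  obtain ⟨l, hl⟩ := exists_length_separating (r := fun a : F => r a)
    (hr.comp Subtype.val_injective)
  obtain ⟨W, hW⟩ := exists_code_of_separating (t := fun a : F => (List.range l).map (r a))
    (fun i j => hl i j) fun a => y a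
  refine ⟨(l, W), fun a ha => ?_⟩
  have := hW ⟨a, ha⟩
  rw [evalCode, Bool.eq_iff_iff, decide_eq_true_iff]
  exact this

theorem exists_injective_omegaOne : ∃ r : OmegaOne → ℕ → ℕ, r.Injective := by
  have h : Cardinal.lift.{0} (Cardinal.mk OmegaOne) ≤ Cardinal.lift.{1} (Cardinal.mk (ℕ → ℕ)) := by
    rw [mk_omegaOne]
    simpa using Cardinal.aleph_one_le_continuum
  obtain ⟨f⟩ := Cardinal.lift_mk_le'.1 h
  exact ⟨f, f.injective⟩

/-! ### Covers: the dominating and the bounded case -/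

section Cover

variable {K : (ℕ → ℕ) → Set CantorCube}

/-- The union of the `K g` over all `g` that agree with `f` below `n`. -/
def node (K : (ℕ → ℕ) → Set CantorCube) (f : ℕ → ℕ) (n : ℕ) : Set CantorCube :=
  {x | ∃ g, (∀ k < n, g k = f k) ∧ x ∈ K g}

theorem node_congr {f g : ℕ → ℕ} {n : ℕ} (h : ∀ k < n, f k = g k) : node K f n = node K g n := by
  ext x
  exact exists_congr fun u => and_congr_left fun _ => forall₂_congr fun k hk => by rw [h k hk]

/-- A deciding cylinder for all nodes cannot miss a node containing its own centre `x`, and `x ∈ K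
f` puts `x` into every node along `f`. -/
theorem exists_nodes_dense (hK : IsOrderPreservingCompactCover K) :
    ∃ (x : CantorCube) (A : Set OmegaOne) (f : ℕ → ℕ), A.Countable ∧ ∀ n, ∀ y ∈ cyl x A,
      ∀ B : Set OmegaOne, B.Countable → ∃ z ∈ cyl y B, z ∈ node K f n := by
  obtain ⟨x, A, hA, h⟩ := exists_deciding fun s : List ℕ =>
    node K (fun k => s.getD k 0) s.length
  obtain ⟨f, hf⟩ := mem_iUnion.1 (hK.cover ▸ mem_univ x)
  refine ⟨x, A, f, hA, fun n => ?_⟩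
  have hn : node K f n = node K (fun k => ((List.range n).map f).getD k 0)
      ((List.range n).map f).length := by
    simp only [List.length_map, List.length_range]
    refine node_congr fun k hk => ?_
    simp [List.getD, hk]
  rw [hn]
  refine (h _).resolve_left fun h' => h' x (self_mem_cyl _ _) ?_
  rw [← hn]
  exact ⟨f, fun _ _ => rfl, hf⟩

/-- If `ω₁` many functions dominate all functions, then some `K f` is BIG. -/
theorem exists_isBIG_of_dominating (hK : IsOrderPreservingCompactCover K)
    {e : OmegaOne → ℕ → ℕ} (he : ∀ g : ℕ → ℕ, ∃ α, ∀ n, g n ≤ e α n) : ∃ f, IsBIG (K f) := by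
  by_contra! hbig
  obtain ⟨x, hx⟩ : ∃ x, ∀ α, ∃ A, A.Countable ∧ ∀ y ∈ cyl x A, y ∉ K (e α) := by
    refine exists_generic (fun α x A => ∀ y ∈ cyl x A, y ∉ K (e α)) ?_ ?_
    · intro α x A hA
      obtain ⟨y, hy, hyK⟩ := not_subset.1 fun h =>
        hbig (e α) (isBIG_of_cyl_subset (hK.isCompact _) hA h)
      obtain ⟨F, hF⟩ := exists_disjoint_cyl_of_notMem (hK.isCompact (e α)).isClosed hyK
      exact ⟨y, hy, A ∪ F, hA.union F.countable_toSet, subset_union_left, fun z hz =>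
        hF z (cyl_subset_cyl (self_mem_cyl _ _) subset_union_right hz)⟩
    · intro α x A y B h hy hAB z hz
      exact h z (cyl_subset_cyl hy hAB hz)
  obtain ⟨g, hg⟩ := mem_iUnion.1 (hK.cover ▸ mem_univ x)
  obtain ⟨α, hα⟩ := he g
  obtain ⟨A, -, hA⟩ := hx α
  exact hA x (self_mem_cyl _ _) (hK.mono _ _ hα hg)

/-- If any `ω₁` many functions are bounded modulo finite sets, then some `K f` is BIG. -/
theorem exists_isBIG_of_bounded (hK : IsOrderPreservingCompactCover K)
    (hB : ∀ e : OmegaOne → ℕ → ℕ, ∃ g : ℕ → ℕ, ∀ α, ∃ N, ∀ n ≥ N, e α n ≤ g n) :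
    ∃ f, IsBIG (K f) := by
  classical
  obtain ⟨x, A, f, hA, hx⟩ := exists_nodes_dense hK
  obtain ⟨r, hr⟩ := exists_injective_omegaOne
  obtain ⟨q, hq⟩ := exists_surjective_nat (ℕ × Finset (List ℕ))
  let d : ℕ → CantorCube := fun k a => if a ∈ A then x a else evalCode (q k) (r a)
  have hd : ∀ k, d k ∈ cyl x A := fun k a ha => by simp [d, ha]
  have hpt : ∀ α k, ∃ h : ℕ → ℕ, (∀ i < k, h i = f i) ∧
      ∃ z ∈ K h, z ∈ cyl (d k) (A ∪ Iio α) := fun α k => by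
    obtain ⟨z, hz, h, hhf, hzh⟩ := hx k (d k) (hd k) _ (hA.union (countable_Iio_omegaOne α))
    exact ⟨h, hhf, z, hzh, hz⟩
  choose h hhf z hzK hz using hpt
  -- A finite maximum bounds all `h α k` at `i`, because `h α k i = f i` once `k > i`.
  let H : OmegaOne → ℕ → ℕ := fun α i => max (f i) ((Finset.range (i + 1)).sup fun k => h α k i)
  have hH : ∀ α k i, h α k i ≤ H α i := fun α k i => by
    rcases lt_or_ge i k with hik | hik
    · rw [hhf α k i hik]
      exact le_max_left _ _
    · refine le_max_of_le_right (Finset.le_sup (f := fun k => h α k i) ?_)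
      simpa [Nat.lt_succ_iff] using hik
  obtain ⟨g, hg⟩ := hB H
  choose N hN using hg
  -- Uncountably many `α` share the threshold and the maximum below it, so one function bounds their
  -- `H α` everywhere.
  obtain ⟨⟨n, V⟩, hS⟩ := exists_not_countable_fiber not_countable_univ_omegaOne
    fun α => (N α, (Finset.range (N α)).sup (H α))
  refine ⟨fun i => max (g i) V, isBIG_of_cyl_subset (x := x) (hK.isCompact _) hA fun w hw => ?_⟩
  by_contra hwK
  obtain ⟨F, hF⟩ := exists_disjoint_cyl_of_notMem (hK.isCompact _).isClosed hwK
  obtain ⟨c, hc⟩ := exists_code hr F w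
  obtain ⟨k, rfl⟩ := hq c
  obtain ⟨δ, hδ⟩ := exists_forall_lt_of_countable F.countable_toSet
  obtain ⟨α, ⟨-, hα⟩, hδα⟩ := exists_le_of_not_countable hS δ
  rw [Prod.mk.injEq] at hα
  refine hF (z α k) (fun a ha => ?_) (hK.mono _ _ (fun i => ?_) (hzK α k))
  · rw [hz α k (Or.inr ((hδ a ha).trans_le hδα))]
    by_cases haA : a ∈ A
    · simpa [d, haA] using (hw haA).symm
    · simpa [d, haA] using hc a ha
  · refine (hH α k i).trans ?_
    rcases lt_or_ge i (N α) with hi | hi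
    · rw [← hα.2]
      exact le_max_of_le_right (Finset.le_sup (f := H α) (Finset.mem_range.2 hi))
    · exact le_max_of_le_left (hN α i hi)

end Cover

/-! ### Unbounded chains and splitting -/

/-- Every uncountable family of finite tuples of functions contains an uncountable subfamily
without isolated points. -/
theorem exists_perfect_subset {κ ι : Type*} [Finite ι] (φ : κ → ι → ℕ → ℕ) {Q : Set κ}
    (hQ : ¬ Q.Countable) :
    ∃ Q' ⊆ Q, ¬ Q'.Countable ∧
      ∀ ξ ∈ Q', ∀ n, ¬ {η ∈ Q' | ∀ i, ∀ k < n, φ η i k = φ ξ i k}.Countable := by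
  let S : κ → ℕ → Set κ := fun ξ n => {η ∈ Q | ∀ i, ∀ k < n, φ η i k = φ ξ i k}
  let bad : Set κ := {ξ ∈ Q | ∃ n, (S ξ n).Countable}
  have hbad : bad.Countable := by
    have hsub : bad ⊆ ⋃ n : ℕ, ⋃ t : ι → Fin n → ℕ,
        {ξ ∈ Q | (S ξ n).Countable ∧ (fun i (k : Fin n) => φ ξ i k) = t} := by
      rintro ξ ⟨hξ, n, hn⟩
      exact mem_iUnion₂.2 ⟨n, _, hξ, hn, rfl⟩
    refine (countable_iUnion fun n => countable_iUnion fun t => ?_).mono hsub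
    rcases eq_empty_or_nonempty
      {ξ ∈ Q | (S ξ n).Countable ∧ (fun i (k : Fin n) => φ ξ i k) = t} with h | ⟨ξ, -, hξ, rfl⟩
    · rw [h]
      exact countable_empty
    · refine hξ.mono fun η hη => ?_
      exact ⟨hη.1, fun i k hk => congrFun (congrFun hη.2.2 i) ⟨k, hk⟩⟩
  have hdiff : ∀ T : Set κ, ¬ T.Countable → ¬ (T \ bad).Countable := fun T hT h =>
    hT ((h.union hbad).mono fun a ha => by
      by_cases hab : a ∈ bad
      · exact Or.inr hab
      · exact Or.inl ⟨ha, hab⟩)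
  refine ⟨Q \ bad, sdiff_subset, hdiff Q hQ, fun ξ hξ n h => ?_⟩
  have hS : ¬ (S ξ n).Countable := fun h' => hξ.2 ⟨hξ.1, n, h'⟩
  exact hdiff _ hS (h.mono fun η hη => show η ∈ {η ∈ Q \ bad | _} from ⟨⟨hη.1.1, hη.2⟩, hη.1.2⟩)

theorem exists_monotone_dominating {ι : Type*} [Countable ι] (g : ι → ℕ → ℕ) (u : ℕ → ℕ) :
    ∃ w : ℕ → ℕ, Monotone w ∧ (∀ n, u n ≤ w n) ∧ ∀ i, ∃ N, ∀ n ≥ N, g i n < w n := by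
  obtain ⟨j, hj⟩ := exists_injective_nat ι
  let h : ℕ → ℕ → ℕ := fun k => Function.extend j g (fun _ _ => 0) k
  have hh : ∀ i, h (j i) = g i := fun i => hj.extend_apply g _ i
  let v : ℕ → ℕ := fun k => u k + (Finset.range (k + 1)).sup (fun l => h l k) + 1
  have hv : ∀ n, v n ≤ (Finset.range (n + 1)).sup v := fun n =>
    Finset.le_sup (Finset.mem_range.2 n.lt_succ_self)
  refine ⟨fun n => (Finset.range (n + 1)).sup v, fun a b hab => ?_, fun n => ?_, fun i =>
    ⟨j i, fun n hn => lt_of_lt_of_le ?_ (hv n)⟩⟩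
  · exact Finset.sup_mono (Finset.range_mono (by lia))
  · exact le_trans (by simp only [v]; lia) (hv n)
  · have : h (j i) n ≤ (Finset.range (n + 1)).sup (fun l => h l n) :=
      Finset.le_sup (f := fun l => h l n) (Finset.mem_range.2 (Nat.lt_succ_of_le hn))
    rw [hh] at this
    simp only [v]
    lia

/-- An increasing unbounded `ω₁`-chain of nondecreasing functions, modulo finite sets. -/
structure IsUnboundedChain (f : OmegaOne → ℕ → ℕ) : Prop where
  monotone : ∀ α, Monotone (f α)
  lt : ∀ α β, α < β → ∃ N, ∀ n ≥ N, f α n < f β n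
  unbounded : ∀ A : Set OmegaOne, ¬ A.Countable → ∀ g : ℕ → ℕ,
    ∃ α ∈ A, ∀ N, ∃ n ≥ N, g n < f α n

theorem exists_isUnboundedChain {e : OmegaOne → ℕ → ℕ}
    (he : ∀ g : ℕ → ℕ, ∃ α, ∀ N, ∃ n ≥ N, g n < e α n) : ∃ f, IsUnboundedChain f := by
  obtain ⟨f, hf⟩ := exists_wellFounded_choice (ι := OmegaOne) (β := ℕ → ℕ)
    (fun α w => Monotone w ∧ ∀ n, e α n ≤ w n) (fun v w => ∃ N, ∀ n ≥ N, v n < w n)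
    (fun α g _ => by
      have := (countable_Iio_omegaOne α).to_subtype
      obtain ⟨w, hw, hu, hg⟩ := exists_monotone_dominating (fun β : Iio α => g β) (e α)
      exact ⟨w, ⟨hw, hu⟩, fun c hc => hg ⟨c, hc⟩⟩)
  refine ⟨f, fun α => (hf α).1.1, fun α β h => (hf β).2 α h, fun A hA g => ?_⟩
  obtain ⟨β, hβ⟩ := he g
  obtain ⟨α, hα, hβα⟩ := exists_le_of_not_countable (not_countable_inter_Ici hA β) β
  obtain ⟨M, hM⟩ : ∃ M, ∀ n ≥ M, f β n ≤ f α n := by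
    rcases hβα.eq_or_lt with rfl | h
    · exact ⟨0, fun _ _ => le_rfl⟩
    · obtain ⟨M, hM⟩ := (hf α).2 β h
      exact ⟨M, fun n hn => (hM n hn).le⟩
  refine ⟨α, hα.1, fun N => ?_⟩
  obtain ⟨n, hn, hlt⟩ := hβ (max N M)
  exact ⟨n, (le_max_left _ _).trans hn,
    hlt.trans_le (((hf β).1.2 n).trans (hM n ((le_max_right _ _).trans hn)))⟩

namespace IsUnboundedChain

variable {f : OmegaOne → ℕ → ℕ}

theorem injective (hf : IsUnboundedChain f) : f.Injective := by
  intro α β h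
  by_contra hne
  rcases lt_or_gt_of_ne hne with hlt | hlt
  · obtain ⟨N, hN⟩ := hf.lt _ _ hlt
    exact (hN N le_rfl).ne (by rw [h])
  · obtain ⟨N, hN⟩ := hf.lt _ _ hlt
    exact (hN N le_rfl).ne (by rw [h])

theorem eventually_le (hf : IsUnboundedChain f) {α β : OmegaOne} (h : α ≤ β) :
    ∃ N, ∀ n ≥ N, f α n ≤ f β n := by
  rcases h.eq_or_lt with rfl | h
  · exact ⟨0, fun _ _ => le_rfl⟩
  · obtain ⟨M, hM⟩ := hf.lt α β h
    exact ⟨M, fun n hn => (hM n hn).le⟩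

theorem eventually_le_all (hf : IsUnboundedChain f) {ι : Type*} [Finite ι] {α : OmegaOne}
    {b : ι → OmegaOne} (h : ∀ i, α ≤ b i) : ∃ N, ∀ i, ∀ n ≥ N, f α n ≤ f (b i) n := by
  cases nonempty_fintype ι
  choose N hN using fun i => hf.eventually_le (h i)
  exact ⟨Finset.univ.sup N, fun i n hn => hN i n ((Finset.le_sup (Finset.mem_univ i)).trans hn)⟩

end IsUnboundedChain

/-- The members of `Q` that follow the prefixes `c i` of length `n i` attain simultaneously
arbitrarily large values at the `n i`. -/
def IsSplit {ι : Type*} (f : OmegaOne → ℕ → ℕ) (b : OmegaOne → ι → OmegaOne) (Q : Set OmegaOne)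
    (n : ι → ℕ) (c : ι → ℕ → ℕ) : Prop :=
  ∀ v, ∃ η ∈ Q, ∀ i, (∀ k < n i, f (b η i) k = c i k) ∧ v < f (b η i) (n i)

theorem Ultrafilter.eventually_eq_or_eventually_lt {κ : Type*} (U : Ultrafilter κ) (u : κ → ℕ) :
    (∃ c, ∀ᶠ v in U, u v = c) ∨ ∀ c, ∀ᶠ v in U, c < u v := by
  by_cases h : ∀ c, ∀ᶠ v in U, c < u v
  · exact Or.inr h
  · push Not at h
    obtain ⟨c, hc⟩ := h
    have hc : Iic c ∈ U.map u := by
      show ∀ᶠ v in U, u v ≤ c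
      exact hc
    obtain ⟨d, -, hd⟩ := Ultrafilter.eq_pure_of_finite_mem (finite_Iic c) hc
    have hmem : ({d} : Set ℕ) ∈ U.map u := by
      rw [hd]
      exact Ultrafilter.mem_pure.2 rfl
    exact Or.inl ⟨d, hmem⟩

/-- Unboundedness gives a place `m` where all coordinates become large together. Along a
nonprincipal ultrafilter each coordinate is constant or tends to infinity at every place; `n i` is
the first place of the latter kind, and the constants before it form the prefix `c i`. -/
theorem IsUnboundedChain.exists_isSplit {f : OmegaOne → ℕ → ℕ} (hf : IsUnboundedChain f)
    {ι : Type*} [Finite ι] {b : OmegaOne → ι → OmegaOne} (hb : ∀ ξ i, ξ ≤ b ξ i)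
    {C : Set OmegaOne} (hC : ¬ C.Countable) (n₀ : ℕ) (c₀ : ι → ℕ → ℕ)
    (hc₀ : ∀ η ∈ C, ∀ i, ∀ k < n₀, f (b η i) k = c₀ i k) :
    ∃ n c, (∀ i, n₀ ≤ n i) ∧ (∀ i, ∀ k < n₀, c i k = c₀ i k) ∧ IsSplit f b C n c := by
  classical
  obtain ⟨m, hm⟩ : ∃ m, ∀ v, ∃ η ∈ C, ∀ i, v < f (b η i) m := by
    by_contra! h
    choose G hG using h
    obtain ⟨α, hα, hαG⟩ := hf.unbounded C hC G
    obtain ⟨N, hN⟩ := hf.eventually_le_all (hb α)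
    obtain ⟨n, hn, hlt⟩ := hαG N
    obtain ⟨i, hi⟩ := hG n α hα
    exact absurd (hlt.trans_le (hN i n hn)) hi.not_gt
  choose η hη hηm using hm
  have hdich := fun i k =>
    Ultrafilter.eventually_eq_or_eventually_lt (hyperfilter ℕ) fun v => f (b (η v) i) k
  have hlarge : ∀ i, ∃ k, ∀ c, ∀ᶠ v in hyperfilter ℕ, c < f (b (η v) i) k := fun i =>
    ⟨m, fun c => ((eventually_ge_atTop c).filter_mono Nat.hyperfilter_le_atTop).mono
      fun v hv => lt_of_le_of_lt hv (hηm v i)⟩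
  have hsmall : ∀ i k, ∃ c, k < Nat.find (hlarge i) →
      ∀ᶠ v in hyperfilter ℕ, f (b (η v) i) k = c := fun i k => by
    by_cases hk : k < Nat.find (hlarge i)
    · obtain ⟨c, hc⟩ := (hdich i k).resolve_right (Nat.find_min (hlarge i) hk)
      exact ⟨c, fun _ => hc⟩
    · exact ⟨0, fun h => (hk h).elim⟩
  choose c hc using hsmall
  have hn₀ : ∀ i, n₀ ≤ Nat.find (hlarge i) := fun i => by
    by_contra! h
    obtain ⟨v, hv⟩ := (Nat.find_spec (hlarge i) (c₀ i (Nat.find (hlarge i)))).exists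
    exact hv.ne' (hc₀ _ (hη v) i _ h)
  refine ⟨fun i => Nat.find (hlarge i), c, hn₀, fun i k hk => ?_, fun v => ?_⟩
  · obtain ⟨v, hv⟩ := (hc i k (hk.trans_le (hn₀ i))).exists
    exact hv.symm.trans (hc₀ _ (hη v) i k hk)
  · have hev : ∀ᶠ w in hyperfilter ℕ, ∀ i, (∀ k < Nat.find (hlarge i), f (b (η w) i) k = c i k) ∧
        v < f (b (η w) i) (Nat.find (hlarge i)) := by
      refine eventually_all.2 fun i => Eventually.and ?_ (Nat.find_spec (hlarge i) v)
      exact (eventually_all_finite (finite_Iio _)).2 fun k hk => hc i k hk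
    obtain ⟨w, hw⟩ := hev.exists
    exact ⟨η w, hη w, hw⟩

/-! ### Counting crossings -/

/-- The number of places below `n` at which `f` starts to exceed `g`. -/
noncomputable def crossingsBelow (f g : ℕ → ℕ) (n : ℕ) : ℕ :=
  -- Truncated subtraction makes the two inequalities contradictory at `k = 0`, so the place 0 never
  -- counts.
  {k | k < n ∧ g k < f k ∧ f (k - 1) ≤ g (k - 1)}.ncard

/-- The number of places at which `f` starts to exceed `g`. -/
noncomputable def crossings (f g : ℕ → ℕ) : ℕ :=
  {k | g k < f k ∧ f (k - 1) ≤ g (k - 1)}.ncard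

theorem crossingsBelow_congr {f f' g g' : ℕ → ℕ} {n : ℕ} (hf : ∀ k < n, f k = f' k)
    (hg : ∀ k < n, g k = g' k) : crossingsBelow f g n = crossingsBelow f' g' n := by
  unfold crossingsBelow
  congr 1
  ext k
  refine and_congr_right fun hk => ?_
  rw [hf k hk, hg k hk, hf (k - 1) (by lia), hg (k - 1) (by lia)]

theorem crossingsBelow_eq_add_one {f g : ℕ → ℕ} {n p n' : ℕ} (hnp : n < p) (hpn' : p < n')
    (hle : ∀ k, n ≤ k → k < p → f k ≤ g k) (hlt : ∀ k, p ≤ k → k < n' → g k < f k) :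
    crossingsBelow f g n' = crossingsBelow f g n + 1 := by
  have h : {k | k < n' ∧ g k < f k ∧ f (k - 1) ≤ g (k - 1)} =
      insert p {k | k < n ∧ g k < f k ∧ f (k - 1) ≤ g (k - 1)} := by
    ext k
    simp only [mem_ofPred_eq, mem_insert_iff]
    constructor
    · rintro ⟨h1, h2, h3⟩
      rcases lt_or_ge k n with h | h
      · exact Or.inr ⟨h, h2, h3⟩
      rcases lt_trichotomy k p with h' | h' | h'
      · exact absurd (hle k h h') h2.not_ge
      · exact Or.inl h'
      · exact absurd (hlt (k - 1) (by lia) (by lia)) h3.not_gt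
    · rintro (rfl | ⟨h1, h2⟩)
      · exact ⟨hpn', hlt k le_rfl hpn', hle _ (by lia) (by lia)⟩
      · exact ⟨by lia, h2⟩
  rw [crossingsBelow, h, ncard_insert_of_notMem (by simp; lia)
    ((finite_Iio n).subset fun k hk => hk.1), crossingsBelow]

theorem crossings_eq_crossingsBelow {f g : ℕ → ℕ} {n : ℕ} (h : ∀ k ≥ n, f k ≤ g k) :
    crossings f g = crossingsBelow f g n := by
  unfold crossings crossingsBelow
  congr 1
  ext k
  refine ⟨fun hk => ⟨?_, hk⟩, fun hk => hk.2⟩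
  by_contra! hkn
  exact absurd (h k hkn) hk.1.not_ge

/-- The two sides overtake each other in turn: the tuple jumps over the single function at the
places `n i`, the single function jumps over the whole tuple at `p`. Monotonicity preserves each
lead, so every round adds exactly one crossing in all coordinates at once. -/
theorem IsUnboundedChain.exists_crossings_eq {f : OmegaOne → ℕ → ℕ} (hf : IsUnboundedChain f)
    {ι : Type*} [Finite ι] {b : OmegaOne → ι → OmegaOne} (hb : ∀ ξ i, ξ ≤ b ξ i)
    {A D Q : Set OmegaOne} (hA₀ : A.Nonempty) (hQ₀ : Q.Nonempty)
    (hA : ∀ α ∈ A, ∀ n, ¬ {β ∈ A | ∀ k < n, f β k = f α k}.Countable)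
    (hQ : ∀ ξ ∈ Q, ∀ n, ¬ {η ∈ Q | ∀ i, ∀ k < n, f (b η i) k = f (b ξ i) k}.Countable)
    {γ : OmegaOne} {N : ℕ} (hN : ∀ ξ ∈ Q, ∀ i, ∀ k ≥ N, f γ k ≤ f (b ξ i) k)
    (hDdense : ∀ α ∈ A, ∀ n, ∃ β ∈ D, ∀ k < n, f β k = f α k) (hDγ : ∀ α ∈ D, α ≤ γ) :
    ∃ v : ι → ℕ, ∀ r, ∃ α ∈ D, ∃ ξ ∈ Q, ∀ i, crossings (f α) (f (b ξ i)) = v i + r := by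
  cases nonempty_fintype ι
  have splitQ : ∀ ξ ∈ Q, ∀ n₀, ∃ n c, (∀ i, n₀ ≤ n i) ∧
      (∀ i, ∀ k < n₀, c i k = f (b ξ i) k) ∧ IsSplit f b Q n c := fun ξ hξ n₀ => by
    obtain ⟨n, c, h1, h2, h3⟩ := hf.exists_isSplit hb (hQ ξ hξ n₀) n₀ (fun i => f (b ξ i))
      fun η hη => hη.2
    refine ⟨n, c, h1, h2, fun v => ?_⟩
    obtain ⟨η, hη, h⟩ := h3 v
    exact ⟨η, hη.1, h⟩
  have splitA : ∀ α ∈ A, ∀ n₀, ∃ (p : ℕ) (c : ℕ → ℕ), n₀ ≤ p ∧ (∀ k < n₀, c k = f α k) ∧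
      ∀ v, ∃ β ∈ A, (∀ k < p, f β k = c k) ∧ v < f β p := fun α hα n₀ => by
    obtain ⟨n, c, h1, h2, h3⟩ := hf.exists_isSplit (ι := Unit) (b := fun ξ _ => ξ)
      (fun ξ _ => le_rfl) (hA α hα n₀) n₀ (fun _ => f α) fun η hη _ => hη.2
    refine ⟨n (), c (), h1 (), h2 (), fun v => ?_⟩
    obtain ⟨η, hη, h⟩ := h3 v
    exact ⟨η, hη.1, h ()⟩
  obtain ⟨α₀, hα₀⟩ := hA₀
  obtain ⟨ξ₀, hξ₀⟩ := hQ₀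
  obtain ⟨n₀, c₀, hn₀, -, hsplit₀⟩ := splitQ ξ₀ hξ₀ N
  have key : ∀ r, ∃ n c, IsSplit f b Q n c ∧ (∀ i, N ≤ n i) ∧ ∃ α ∈ A,
      ∀ i, crossingsBelow (f α) (c i) (n i) = crossingsBelow (f α₀) (c₀ i) (n₀ i) + r := by
    intro r
    induction r with
    | zero => exact ⟨n₀, c₀, hsplit₀, hn₀, α₀, hα₀, fun i => rfl⟩
    | succ r ih =>
      obtain ⟨n, c, hsplit, hNn, α, hα, hcount⟩ := ih
      have hn : ∀ i, n i < Finset.univ.sup n + 1 := fun i =>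
        Nat.lt_succ_of_le (Finset.le_sup (Finset.mem_univ i))
      obtain ⟨p, u, hp, hu, hsplitA⟩ := splitA α hα (Finset.univ.sup n + 1)
      -- The tuple jumps above everything the prefix `u` attains before `p`.
      obtain ⟨η, hη, hηc⟩ := hsplit ((Finset.range p).sup u)
      obtain ⟨n', c', hn', hc', hsplit'⟩ := splitQ η hη (p + 1)
      -- The single function jumps at `p` above every value of the new prefixes `c'`.
      obtain ⟨β, hβ, hβu, hβp⟩ :=
        hsplitA (Finset.univ.sup fun i => (Finset.range (n' i)).sup (c' i))
      refine ⟨n', c', hsplit', fun i => ?_, β, hβ, fun i => ?_⟩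
      · have := hNn i
        have := hn i
        have := hn' i
        lia
      · have hnp : n i < p := (hn i).trans_le hp
        rw [crossingsBelow_eq_add_one hnp (hn' i), ← add_assoc, ← hcount i]
        · congr 1
          refine crossingsBelow_congr (fun k hk => ?_) fun k hk => ?_
          · rw [hβu k (hk.trans hnp), hu k (hk.trans (hn i))]
          · rw [hc' i k (by lia), (hηc i).1 k hk]
        · intro k hk hkp
          rw [hβu k hkp, hc' i k (by lia)]
          exact (Finset.le_sup (f := u) (Finset.mem_range.2 hkp)).trans
            ((hηc i).2.le.trans (hf.monotone _ hk))
        · intro k hpk hk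
          have h1 : c' i k ≤ (Finset.range (n' i)).sup (c' i) :=
            Finset.le_sup (Finset.mem_range.2 hk)
          have h2 := Finset.le_sup (f := fun i => (Finset.range (n' i)).sup (c' i))
            (Finset.mem_univ i)
          exact (h1.trans h2).trans_lt (hβp.trans_le (hf.monotone β hpk))
  refine ⟨fun i => crossingsBelow (f α₀) (c₀ i) (n₀ i), fun r => ?_⟩
  obtain ⟨n, c, hsplit, hNn, α, hα, hcount⟩ := key r
  obtain ⟨β, hβ, hβα⟩ := hDdense α hα (Finset.univ.sup n)
  obtain ⟨M, hM⟩ := hf.eventually_le (hDγ β hβ)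
  -- A jump above `f β M` prevents crossings up to `M`; from `M` on, `f β ≤ f γ ≤ f (b η i)` does
  -- so.
  obtain ⟨η, hη, hηc⟩ := hsplit (f β M)
  refine ⟨β, hβ, η, hη, fun i => ?_⟩
  rw [crossings_eq_crossingsBelow (n := n i), ← hcount i]
  · refine crossingsBelow_congr (fun k hk => hβα k ?_) (hηc i).1
    exact hk.trans_le (Finset.le_sup (Finset.mem_univ i))
  · intro k hk
    rcases le_total k M with h | h
    · exact (hf.monotone β h).trans ((hηc i).2.le.trans (hf.monotone _ hk))
    · exact (hM k h).trans (hN η hη i k ((hNn i).trans hk))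

theorem exists_countable_dense_subset {κ : Type*} (φ : κ → ℕ → ℕ) (A : Set κ) :
    ∃ D ⊆ A, D.Countable ∧ ∀ α ∈ A, ∀ n, ∃ β ∈ D, ∀ k < n, φ β k = φ α k := by
  have h : ∀ n : ℕ, ∃ D ⊆ A, D.Countable ∧ ∀ α ∈ A, ∃ β ∈ D, ∀ k < n, φ β k = φ α k := by
    intro n
    obtain ⟨D, hDA, hD⟩ := exists_subset_bijOn A fun α (k : Fin n) => φ α k
    refine ⟨D, hDA, countable_of_injective_of_countable_image hD.injOn (to_countable _),
      fun α hα => ?_⟩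
    obtain ⟨β, hβ, h⟩ := hD.surjOn (mem_image_of_mem _ hα)
    exact ⟨β, hβ, fun k hk => congrFun h ⟨k, hk⟩⟩
  choose D hDA hD h using h
  refine ⟨⋃ n, D n, iUnion_subset hDA, countable_iUnion hD, fun α hα n => ?_⟩
  obtain ⟨β, hβ, h⟩ := h n α hα
  exact ⟨β, mem_iUnion.2 ⟨n, hβ⟩, h⟩

/-- On each dyadic block the exponent encodes both a value and a length, so every value fills
arbitrarily long intervals. This absorbs the differing offsets `v i` of the crossing numbers. -/
theorem exists_constant_on_long_intervals (T : Type*) [Countable T] [Nonempty T] :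
    ∃ E : ℕ → T, ∀ q R, ∃ r, ∀ v ≤ R, E (v + r) = q := by
  obtain ⟨u, hu⟩ := exists_surjective_nat T
  refine ⟨fun o => u (Nat.unpair (Nat.log 2 o)).1, fun q R => ?_⟩
  obtain ⟨a, rfl⟩ := hu q
  refine ⟨2 ^ Nat.pair a R, fun v hv => ?_⟩
  have h : R < 2 ^ Nat.pair a R := lt_of_le_of_lt (Nat.right_le_pair a R) Nat.lt_two_pow_self
  have : Nat.log 2 (v + 2 ^ Nat.pair a R) = Nat.pair a R :=
    Nat.log_eq_of_pow_le_of_lt_pow (by lia) (by rw [pow_succ]; lia)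
  simp [this]

/-- The crossing number of `f α` with `f β` selects a code, which is evaluated at `f β`. After
thinning `Q` so that sizes, prescribed values and separating prefixes agree, one code realises all
the conditions; `r` is chosen so that every `v i + r` selects it. -/
theorem exists_forall_mem_cyl {f : OmegaOne → ℕ → ℕ} (hf : IsUnboundedChain f) :
    ∃ x : OmegaOne → CantorCube, ∀ A : Set OmegaOne, ¬ A.Countable →
      ∃ D ⊆ A, D.Countable ∧ ∀ (F : OmegaOne → Finset OmegaOne) (y : OmegaOne → CantorCube),
        (∀ ξ, ∀ a ∈ F ξ, ξ ≤ a) → ∀ Q : Set OmegaOne, ¬ Q.Countable →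
          ∃ ξ ∈ Q, ∃ α ∈ D, x α ∈ cyl (y ξ) (F ξ) := by
  classical
  obtain ⟨E, hE⟩ := exists_constant_on_long_intervals (ℕ × Finset (List ℕ))
  refine ⟨fun α β => evalCode (E (crossings (f α) (f β))) (f β), fun A hA => ?_⟩
  obtain ⟨A', hA'A, hA'unc, hA'⟩ := exists_perfect_subset (fun α (_ : Unit) => f α) hA
  obtain ⟨D, hDA', hD, hDdense⟩ := exists_countable_dense_subset f A'
  refine ⟨D, hDA'.trans hA'A, hD, fun F y hF Q hQ => ?_⟩
  obtain ⟨γ, hγ⟩ := exists_forall_lt_of_countable hD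
  obtain ⟨m, hm⟩ := exists_not_countable_fiber (not_countable_inter_Ici hQ γ) fun ξ => (F ξ).card
  -- The constant default keeps `ξ ≤ b ξ i` valid for all `ξ`.
  let b : OmegaOne → Fin m → OmegaOne := fun ξ =>
    if h : (F ξ).card = m then (F ξ).orderEmbOfFin h else fun _ => ξ
  have hbF : ∀ ξ, (h : (F ξ).card = m) → b ξ = (F ξ).orderEmbOfFin h := fun ξ h => dif_pos h
  have hb : ∀ ξ i, ξ ≤ b ξ i := fun ξ i => by
    by_cases h : (F ξ).card = m
    · rw [hbF ξ h]
      exact hF ξ _ (Finset.orderEmbOfFin_mem _ _ _)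
    · simp [b, h]
  have hdata : ∀ ξ ∈ {ξ ∈ Q ∩ Ici γ | (F ξ).card = m},
      ∃ N l, (∀ i, ∀ k ≥ N, f γ k ≤ f (b ξ i) k) ∧
        ∀ i j, (List.range l).map (f (b ξ i)) = (List.range l).map (f (b ξ j)) → i = j := by
    rintro ξ ⟨⟨-, hγξ⟩, hcard⟩
    obtain ⟨N, hN⟩ := hf.eventually_le_all fun i => (mem_Ici.1 hγξ).trans (hb ξ i)
    have hinj : (b ξ).Injective := by
      rw [hbF ξ hcard]
      exact ((F ξ).orderEmbOfFin hcard).injective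
    obtain ⟨l, hl⟩ := exists_length_separating (hf.injective.comp hinj)
    exact ⟨N, l, hN, hl⟩
  choose! N l hN hl using hdata
  obtain ⟨⟨N₀, l₀, p, t⟩, hS⟩ := exists_not_countable_fiber hm fun ξ =>
    (N ξ, l ξ, fun i => y ξ (b ξ i), fun i => (List.range (l ξ)).map (f (b ξ i)))
  obtain ⟨S, hSsub, hSunc, hSperf⟩ := exists_perfect_subset (fun ξ i => f (b ξ i)) hS
  have hSmem : ∀ ξ ∈ S, (F ξ).card = m ∧ (∀ i, ∀ k ≥ N₀, f γ k ≤ f (b ξ i) k) ∧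
      (∀ i, y ξ (b ξ i) = p i) ∧ (∀ i, (List.range l₀).map (f (b ξ i)) = t i) ∧
        t.Injective := by
    intro ξ hξ
    obtain ⟨h1, h2⟩ := hSsub hξ
    simp only [Prod.mk.injEq] at h2
    obtain ⟨rfl, rfl, rfl, rfl⟩ := h2
    exact ⟨h1.2, hN ξ h1, fun _ => rfl, fun _ => rfl, fun i j => hl ξ h1 i j⟩
  have hSne : S.Nonempty := nonempty_iff_ne_empty.2 fun h => hSunc (h ▸ countable_empty)
  have hA'ne : A'.Nonempty := nonempty_iff_ne_empty.2 fun h => hA'unc (h ▸ countable_empty)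
  obtain ⟨v, hv⟩ := hf.exists_crossings_eq hb hA'ne hSne
    (fun α hα n h => hA' α hα n (h.mono fun β hβ =>
      show β ∈ {β ∈ A' | ∀ k < n, f β k = f α k} from ⟨hβ.1, hβ.2 ()⟩)) hSperf
    (fun ξ hξ => (hSmem ξ hξ).2.1) hDdense fun α hα => (hγ α hα).le
  obtain ⟨W, hW⟩ := exists_code_of_separating (hSmem _ hSne.some_mem).2.2.2.2 p
  obtain ⟨r, hr⟩ := hE (l₀, W) (Finset.univ.sup v)
  obtain ⟨α, hα, ξ, hξ, h⟩ := hv r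
  obtain ⟨hcard, -, hp, ht, -⟩ := hSmem ξ hξ
  refine ⟨ξ, (hSsub hξ).1.1.1, α, hα, fun a ha => ?_⟩
  obtain ⟨i, rfl⟩ : ∃ i, b ξ i = a := by
    have : a ∈ range ((F ξ).orderEmbOfFin hcard) := by
      rw [Finset.range_orderEmbOfFin]
      exact ha
    rwa [← hbF ξ hcard] at this
  show evalCode (E (crossings (f α) (f (b ξ i)))) (f (b ξ i)) = y ξ (b ξ i)
  rw [h i, hr _ (Finset.le_sup (Finset.mem_univ i)), hp i, Bool.eq_iff_iff, ← hW i, ← ht i]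
  simp [evalCode]

/-! ### The remaining case and the conclusion -/

/-- If there is an unbounded family of `ω₁` many functions but none that dominates, then some
`K f` is BIG. -/
theorem exists_isBIG_of_isUnboundedChain {K : (ℕ → ℕ) → Set CantorCube}
    (hK : IsOrderPreservingCompactCover K) {f : OmegaOne → ℕ → ℕ} (hf : IsUnboundedChain f)
    (hD : ∀ e : OmegaOne → ℕ → ℕ, ∃ g : ℕ → ℕ, ∀ α, ∃ n, e α n ≤ g n) : ∃ f, IsBIG (K f) := by
  classical
  obtain ⟨x, hx⟩ := exists_forall_mem_cyl hf
  choose φ hφ using fun α => mem_iUnion.1 (hK.cover ▸ mem_univ (x α))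
  obtain ⟨A, -, hAunc, hA⟩ := exists_perfect_subset (fun α (_ : Unit) => φ α)
    not_countable_univ_omegaOne
  obtain ⟨α₀, hα₀⟩ : A.Nonempty := nonempty_iff_ne_empty.2 fun h => hAunc (h ▸ countable_empty)
  have hseq : ∀ n : ℕ, ∃ d : ℕ → OmegaOne, (∀ i, ∀ k < n, φ (d i) k = φ α₀ k) ∧
      ∀ (F : OmegaOne → Finset OmegaOne) (y : OmegaOne → CantorCube),
        (∀ ξ, ∀ a ∈ F ξ, ξ ≤ a) → ∀ Q : Set OmegaOne, ¬ Q.Countable →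
          ∃ ξ ∈ Q, ∃ i, x (d i) ∈ cyl (y ξ) (F ξ) := by
    intro n
    obtain ⟨D, hDA, hD, h⟩ := hx _ (hA α₀ hα₀ n)
    obtain ⟨-, -, α, hα, -⟩ := h (fun _ => ∅) (fun _ => x α₀) (by simp) univ
      not_countable_univ_omegaOne
    obtain ⟨d, rfl⟩ := hD.exists_eq_range ⟨α, hα⟩
    refine ⟨d, fun i => (hDA (mem_range_self i)).2 (), fun F y hF Q hQ => ?_⟩
    obtain ⟨ξ, hξ, -, ⟨i, rfl⟩, h⟩ := h F y hF Q hQ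
    exact ⟨ξ, hξ, i, h⟩
  choose d hdφ hd using hseq
  obtain ⟨s, hs⟩ : ∃ s : OmegaOne → Finset OmegaOne × Finset OmegaOne, s.Surjective := by
    have : Cardinal.mk OmegaOne = Cardinal.mk (Finset OmegaOne × Finset OmegaOne) := by
      rw [Cardinal.mk_prod, Cardinal.lift_id, Cardinal.mk_finset_of_infinite,
        Cardinal.mul_eq_self (Cardinal.infinite_iff.1 inferInstance)]
    obtain ⟨e⟩ := Cardinal.eq.1 this
    exact ⟨e, e.surjective⟩
  let z : OmegaOne → CantorCube := fun α a => decide (a ∈ (s α).2)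
  -- Each of the $\aleph_1$ conditions yields the function sending a level `n` to the index of a
  -- point `x (d n i)` that meets it (arbitrary if none does); `g` catches each of these functions
  -- at some level.
  obtain ⟨g, hg⟩ := hD fun α n => Classical.epsilon fun i => x (d n i) ∈ cyl (z α) (s α).1
  -- At place `k` only levels `n ≤ k` matter: at higher levels the indices agree with `φ α₀` there.
  let G : ℕ → ℕ := fun k => max (φ α₀ k)
    ((Finset.range (k + 1)).sup fun n => (Finset.range (g n + 1)).sup fun i => φ (d n i) k)
  have hG : ∀ n, ∀ i ≤ g n, x (d n i) ∈ K G := by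
    intro n i hi
    refine hK.mono _ _ (fun k => ?_) (hφ (d n i))
    rcases lt_or_ge k n with hk | hk
    · rw [hdφ n i k hk]
      exact le_max_left _ _
    · refine le_max_of_le_right ?_
      have h1 : φ (d n i) k ≤ (Finset.range (g n + 1)).sup fun i => φ (d n i) k :=
        Finset.le_sup (f := fun i => φ (d n i) k) (Finset.mem_range.2 (by lia))
      exact h1.trans (Finset.le_sup
        (f := fun n => (Finset.range (g n + 1)).sup fun i => φ (d n i) k)
        (Finset.mem_range.2 (by lia)))
  refine ⟨G, ?_⟩
  by_contra hbig
  have hmiss : ∀ δ : OmegaOne, ∃ (y : CantorCube) (F : Finset OmegaOne),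
      (∀ a ∈ F, δ ≤ a) ∧ ∀ k ∈ K G, k ∉ cyl y F := by
    intro δ
    by_contra! h
    exact hbig (isBIG_of_forall_meets (hK.isCompact G) δ h)
  choose y F hF hmiss using hmiss
  have hQ : ∀ n, {ξ | ∀ i, x (d n i) ∉ cyl (y ξ) (F ξ)}.Countable := by
    intro n
    by_contra h
    obtain ⟨ξ, hξ, i, hi⟩ := hd n F y hF _ h
    exact hξ i hi
  -- One missed condition is met at every level by some `x (d n i)`, and at the level where `g` is
  -- large enough that point lies in `K G`.
  obtain ⟨ξ, hξ⟩ : ∃ ξ, ξ ∉ ⋃ n, {ξ | ∀ i, x (d n i) ∉ cyl (y ξ) (F ξ)} := by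
    by_contra! h
    exact not_countable_univ_omegaOne ((countable_iUnion hQ).mono fun a _ => h a)
  obtain ⟨α, hα⟩ := hs (F ξ, (F ξ).filter fun a => y ξ a = true)
  have hcyl : cyl (z α) (s α).1 = cyl (y ξ) (F ξ) := by
    have hfst : (s α).1 = F ξ := by rw [hα]
    rw [hfst]
    ext w
    have hzy : EqOn (z α) (y ξ) (F ξ) := fun a ha => by
      have ha : a ∈ F ξ := ha
      simp [z, hα, ha]
    exact ⟨fun h => EqOn.trans h hzy, fun h => EqOn.trans h hzy.symm⟩
  obtain ⟨n, hn⟩ := hg α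
  refine hmiss ξ _ (hG n _ hn) ?_
  rw [← hcyl]
  refine Classical.epsilon_spec (p := fun i => x (d n i) ∈ cyl (z α) (s α).1) ?_
  by_contra! h
  exact hξ (mem_iUnion.2 ⟨n, fun i => hcyl ▸ h i⟩)

theorem mainTheorem3 (K : (ℕ → ℕ) → Set CantorCube) (hK : IsOrderPreservingCompactCover K) :
    (∃ f : ℕ → ℕ, IsBIG (K f)) ∧
      ∀ f : ℕ → ℕ, IsBIG (K f) → ∃ ρ : TreeNode, ρ.cylinder ⊆ K f := by
  refine ⟨?_, fun f hf => hf.exists_cylinder_subset⟩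
  by_cases hD : ∀ e : OmegaOne → ℕ → ℕ, ∃ g : ℕ → ℕ, ∀ α, ∃ n, e α n ≤ g n
  · by_cases hB : ∀ e : OmegaOne → ℕ → ℕ, ∃ g : ℕ → ℕ, ∀ α, ∃ N, ∀ n ≥ N, e α n ≤ g n
    · exact exists_isBIG_of_bounded hK hB
    · push Not at hB
      obtain ⟨e, he⟩ := hB
      obtain ⟨f, hf⟩ := exists_isUnboundedChain he
      exact exists_isBIG_of_isUnboundedChain hK hf hD
  · push Not at hD
    obtain ⟨e, he⟩ := hD
    refine exists_isBIG_of_dominating (e := e) hK fun g => ?_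
    obtain ⟨α, hα⟩ := he g
    exact ⟨α, fun n => (hα n).le⟩
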